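/- Let $L$ be a first-order language with equality $=$, propositional constants $\mathrm{true},\mathrm{false}$, a denumerable set of variables, arbitrary (possibly infinite) sets of function and predicate symbols, and at least one constant. A *query* is a formula built from $\mathrm{true}$, $\mathrm{false}$, equations $s=t$ and atoms $p(s_1,\dots,s_n)$ using $\wedge$ and $\exists$; $|Q|$ denotes the number of occurrences of atoms in $Q$. A *pre-interpretation* $J$ of $L$ is a non-empty set $U$ with an interpretation of the function symbols on it; equality is interpreted as identity. A *valuation* $h$ is a map from the variables to $U$, extended to terms. An *interpretation based on* $J$ is a set of generalized atoms $p(d_1,\dots,d_n)$, $d_i\in U$ (those that are true). $J$ is a model of the *free equality axioms* $\mathrm{FEA}_L$ if every function symbol is interpreted by an injective map, distinct function symbols have disjoint ranges, and $h(x)\neq h(t)$ for every valuation $h$, variable $x$ and term $t\not\equiv x$ in which $x$ occurs. A query is *consistent* if it is true in some interpretation based on some model $J$ of $\mathrm{FEA}_L$, under some valuation. For a finite sequence $\bar I$ of $|Q|$ interpretations based on $J$, the solution set $[Q]_J(\bar I)$ is the set of valuations defined by: $[\mathrm{true}]_J(\varepsilon)$ consists of all valuations and $[\mathrm{false}]_J(\varepsilon)=\emptyset$,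 where $\varepsilon$ is the empty sequence; $[s=t]_J(\varepsilon)=\{h: h(s)=h(t)\}$; $[A]_J(I)=\{h: h(A)\in I\}$ for an atom $A$; $[Q_1\wedge Q_2]_J(\bar I_1\bar I_2)=[Q_1]_J(\bar I_1)\cap[Q_2]_J(\bar I_2)$ where $|\bar I_i|=|Q_i|$; $[(\exists x)Q]_J(\bar I)=\{h: h[x\mapsto d]\in[Q]_J(\bar I)\text{ for some }d\in U\}$. Write $Q\preceq Q'$ ("$Q'$ is a generalization of $Q$") if for every model $J$ of $\mathrm{FEA}_L$ one has $|Q|=|Q'|$ and $[Q]_J(\bar I)\subseteq[Q']_J(\bar I)$ for all $\bar I$ of length $|Q|$; $Q\approx Q'$ if $Q\preceq Q'$ and $Q'\preceq Q$; and $Q\prec Q'$ if $Q\preceq Q'$ but not $Q'\preceq Q$. Then: 1. for every consistent query $Q$, the set of generalizations $\{Q' : Q\preceq Q'\}$ consists of only finitely many $\approx$-classes; 2. there is no infinite sequence of queries $Q_0\prec Q_1\prec Q_2\prec\cdots$. -/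

import Mathlib

universe u v w

namespace ConjQuery

/-- A pre-interpretation: a non-empty domain with an interpretation of the function symbols. -/
structure PreInterpretation (L : FirstOrder.Language.{u, v}) where
  Carrier : Type w
  nonempty : Nonempty Carrier
  fn : {n : ℕ} → L.Functions n → (Fin n → Carrier) → Carrier

namespace PreInterpretation

variable {L : FirstOrder.Language.{u, v}} (J : PreInterpretation.{u, v, w} L)

/-- Valuations over `J`; the variables are the natural numbers. -/
abbrev Valuation : Type w := ℕ → J.Carrier

/-- The homomorphic extension of a valuation to all terms. -/
def eval (h : J.Valuation) : L.Term ℕ → J.Carrier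
  | .var x => h x
  | .func f ts => J.fn f (fun i => eval h (ts i))

/-- The `J`-base: generalized atoms `p(d₁, …, dₙ)` with `dᵢ` in the domain of `J`. -/
abbrev Base : Type (max v w) := Σ n : ℕ, L.Relations n × (Fin n → J.Carrier)

/-- An interpretation based on `J`, identified with a subset of the `J`-base. -/
abbrev Interpretation : Type (max v w) := Set J.Base

/-- `J` is a model of the free equality axioms of `L`. Each field says that the axioms of one
of the three groups are true in `J` under all valuations. -/
structure ModelsFEA : Prop where
  injective : ∀ {n : ℕ} (f : L.Functions n) (x y : Fin n → J.Carrier),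
    J.fn f x = J.fn f y ↔ ∀ i, x i = y i
  disjoint : ∀ {n m : ℕ} (f : L.Functions n) (g : L.Functions m),
    (⟨n, f⟩ : Σ k, L.Functions k) ≠ ⟨m, g⟩ →
      ∀ (x : Fin n → J.Carrier) (y : Fin m → J.Carrier), J.fn f x ≠ J.fn g y
  acyclic : ∀ (x : ℕ) (t : L.Term ℕ), t ≠ FirstOrder.Language.Term.var x → x ∈ t.varFinset →
    ∀ h : J.Valuation, h x ≠ J.eval h t

end PreInterpretation

/-- Queries, i.e. positive conjunctive queries: formulas built from the propositional
constants, equations and atoms by conjunction and existential quantification. -/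
inductive Query (L : FirstOrder.Language.{u, v}) : Type (max u v)
  | tru : Query L
  | fls : Query L
  | eq (s t : L.Term ℕ) : Query L
  | atom {n : ℕ} (p : L.Relations n) (ts : Fin n → L.Term ℕ) : Query L
  | and (Q₁ Q₂ : Query L) : Query L
  | ex (x : ℕ) (Q : Query L) : Query L

namespace Query

variable {L : FirstOrder.Language.{u, v}}

/-- The number `|Q|` of occurrences of atoms in `Q`. -/
def card : Query L → ℕ
  | tru => 0
  | fls => 0
  | eq _ _ => 0
  | atom _ _ => 1
  | and Q₁ Q₂ => Q₁.card + Q₂.card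
  | ex _ Q => Q.card

/-- Ordinary truth of a query in an interpretation `I` based on `J`, under a valuation. -/
def Holds (J : PreInterpretation.{u, v, w} L) (I : J.Interpretation) :
    Query L → J.Valuation → Prop
  | tru, _ => True
  | fls, _ => False
  | eq s t, h => J.eval h s = J.eval h t
  | atom p ts, h => (⟨_, p, fun i => J.eval h (ts i)⟩ : J.Base) ∈ I
  | and Q₁ Q₂, h => Holds J I Q₁ h ∧ Holds J I Q₂ h
  | ex x Q, h => ∃ d : J.Carrier, Holds J I Q (Function.update h x d)

/-- The set of solutions of `Q` in a multiinterpretation (a finite sequence of interpretations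
based on `J`, one for each occurrence of an atom). Only meaningful when the length of the
sequence is `Q.card`. -/
def msol (J : PreInterpretation.{u, v, w} L) :
    Query L → List J.Interpretation → Set J.Valuation
  | tru, _ => Set.univ
  | fls, _ => ∅
  | eq s t, _ => {h | J.eval h s = J.eval h t}
  | atom p ts, Is =>
      {h | ∃ I, Is = [I] ∧ (⟨_, p, fun i => J.eval h (ts i)⟩ : J.Base) ∈ I}
  | and Q₁ Q₂, Is => msol J Q₁ (Is.take Q₁.card) ∩ msol J Q₂ (Is.drop Q₁.card)
  | ex x Q, Is => {h | ∃ d : J.Carrier, Function.update h x d ∈ msol J Q Is}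

/-- The preorder `Q ⪯_J Q'`. -/
def LeIn (J : PreInterpretation.{u, v, w} L) (Q Q' : Query L) : Prop :=
  Q.card = Q'.card ∧
    ∀ Is : List J.Interpretation, Is.length = Q.card → Q.msol J Is ⊆ Q'.msol J Is

/-- `Q ⪯ Q'`: the query `Q'` is more general than `Q` (a generalization of `Q`). -/
def Le (Q Q' : Query L) : Prop :=
  ∀ J : PreInterpretation.{u, v, w} L, J.ModelsFEA → LeIn J Q Q'

/-- `Q ≺ Q'`. -/
def Lt (Q Q' : Query L) : Prop :=
  Le.{u, v, w} Q Q' ∧ ¬ Le.{u, v, w} Q' Q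

/-- `Q ≈ Q'`. -/
def Equivalent (Q Q' : Query L) : Prop :=
  Le.{u, v, w} Q Q' ∧ Le.{u, v, w} Q' Q

/-- `Q` is true in some model of the free equality axioms, under some valuation. -/
def Consistent (Q : Query L) : Prop :=
  ∃ J : PreInterpretation.{u, v, w} L, J.ModelsFEA ∧
    ∃ (I : J.Interpretation) (h : J.Valuation), Q.Holds J I h

theorem Le.refl (Q : Query L) : Le.{u, v, w} Q Q :=
  fun _ _ => ⟨rfl, fun _ _ => subset_rfl⟩

theorem Le.trans {Q₁ Q₂ Q₃ : Query L} (h₁ : Le.{u, v, w} Q₁ Q₂) (h₂ : Le.{u, v, w} Q₂ Q₃) :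
    Le.{u, v, w} Q₁ Q₃ :=
  fun J hJ => ⟨(h₁ J hJ).1.trans (h₂ J hJ).1, fun Is hl =>
    ((h₁ J hJ).2 Is hl).trans ((h₂ J hJ).2 Is (hl.trans (h₁ J hJ).1))⟩

/-- Equivalence of queries as a setoid. -/
def equivalentSetoid (L : FirstOrder.Language.{u, v}) : Setoid (Query L) where
  r := Equivalent.{u, v, w}
  iseqv := ⟨fun Q => ⟨Le.refl Q, Le.refl Q⟩, fun h => ⟨h.2, h.1⟩,
    fun h₁ h₂ => ⟨h₁.1.trans h₂.1, h₂.2.trans h₁.2⟩⟩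

/-- The set of `≈`-classes of the generalizations of `Q`. -/
def generalizationClasses (Q : Query L) : Set (Quotient (equivalentSetoid.{u, v, w} L)) :=
  Quotient.mk (equivalentSetoid.{u, v, w} L) '' {Q' | Le.{u, v, w} Q Q'}

end Query

end ConjQuery

/-!
A solution of a query, taken together with the generalized atoms it requires, is a family of
elements of the domain. Over models of the free equality axioms all that matters about such a family
are its path constraints, which say that two constituents of its members agree or that a constituent
has a given head symbol: if all path constraints of `g` hold for `r`, and the model of `g` is
well-founded, then a homomorphism carries `g` to `r`.

The solutions of a query are closed under homomorphic images and products. Every path constraint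
that they do not all share is refuted by some solution, and pairing with it removes the constraint.
If one solution `s` in a well-founded model has only finitely many nontrivial path constraints,
finitely many such products give a generic solution, whose constraints are those common to all
solutions; every solution is a homomorphic image of it. So the solutions are determined by their
common path constraints.

A consistent query has such a solution `s` in terms: finitely many elements of the domain and
finitely many variables are involved in its truth, and all other variables can be sent to
themselves. Then `s` solves every generalization as well, so that the common path constraints of a
generalization form a subset of the path constraints of `s`, and only finitely many are possible.
A strictly increasing sequence consists, from its second member on, of generalizations of a
consistent query.
-/

namespace ConjQuery

open FirstOrder Function Relation

universe w' w₁ w₂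

theorem mem_varFinset_func {L : FirstOrder.Language.{u, v}} {n : ℕ} {f : L.Functions n}
    {ts : Fin n → L.Term ℕ} {x : ℕ} :
    x ∈ (Language.Term.func f ts).varFinset ↔ ∃ i, x ∈ (ts i).varFinset := by
  simp [Language.Term.varFinset]

namespace PreInterpretation

variable {L : FirstOrder.Language.{u, v}} {J : PreInterpretation.{u, v, w} L}
  {J' : PreInterpretation.{u, v, w'} L}

/-- `ρ` commutes with every application of a function symbol of `J` whose arguments and value lie
in `V`; a homomorphism is the case `V = Set.univ`. -/
def HomOn (J : PreInterpretation.{u, v, w} L) (J' : PreInterpretation.{u, v, w'} L)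
    (V : Set J.Carrier) (ρ : J.Carrier → J'.Carrier) : Prop :=
  ∀ ⦃n : ℕ⦄ (f : L.Functions n) (x : Fin n → J.Carrier), J.fn f x ∈ V → (∀ i, x i ∈ V) →
    ρ (J.fn f x) = J'.fn f (ρ ∘ x)

theorem HomOn.mono {V V' : Set J.Carrier} {ρ : J.Carrier → J'.Carrier} (hρ : J.HomOn J' V' ρ)
    (hV : V ⊆ V') : J.HomOn J' V ρ :=
  fun _ f x hx hy => hρ f x (hV hx) fun i => hV (hy i)

theorem HomOn.map_fn {ρ : J.Carrier → J'.Carrier} (hρ : J.HomOn J' Set.univ ρ) {n : ℕ}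
    (f : L.Functions n) (x : Fin n → J.Carrier) : ρ (J.fn f x) = J'.fn f (ρ ∘ x) :=
  hρ f x trivial fun _ => trivial

/-- The values under `h` of the subterms of a term. -/
def subtermValues (J : PreInterpretation.{u, v, w} L) (h : J.Valuation) :
    L.Term ℕ → Set J.Carrier
  | .var x => {h x}
  | .func f ts => insert (J.eval h (.func f ts)) (⋃ i, subtermValues J h (ts i))

theorem finite_subtermValues (h : J.Valuation) (t : L.Term ℕ) :
    (J.subtermValues h t).Finite := by
  induction t with
  | var x => exact Set.finite_singleton _
  | func f ts ih => exact (Set.finite_iUnion ih).insert _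

theorem eval_mem_subtermValues (h : J.Valuation) (t : L.Term ℕ) :
    J.eval h t ∈ J.subtermValues h t := by
  cases t with
  | var x => rfl
  | func f ts => exact Set.mem_insert _ _

theorem HomOn.eval_eq {ρ : J.Carrier → J'.Carrier} {h : J.Valuation} {h' : J'.Valuation}
    {t : L.Term ℕ} (hρ : J.HomOn J' (J.subtermValues h t) ρ)
    (hh : ∀ x ∈ t.varFinset, h' x = ρ (h x)) : J'.eval h' t = ρ (J.eval h t) := by
  induction t with
  | var x => exact hh x (by simp [Language.Term.varFinset])
  | func f ts ih =>
    have hsub (i) : J.subtermValues h (ts i) ⊆ J.subtermValues h (.func f ts) :=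
      (Set.subset_iUnion (fun i => J.subtermValues h (ts i)) i).trans (Set.subset_insert _ _)
    have hargs (i) : J'.eval h' (ts i) = ρ (J.eval h (ts i)) :=
      ih i (hρ.mono (hsub i)) fun x hx => hh x (mem_varFinset_func.2 ⟨i, hx⟩)
    calc J'.eval h' (.func f ts) = J'.fn f (ρ ∘ fun i => J.eval h (ts i)) :=
          congrArg (J'.fn f) (funext hargs)
      _ = ρ (J.eval h (.func f ts)) :=
          (hρ f _ (eval_mem_subtermValues h (.func f ts)) fun i =>
            hsub i (eval_mem_subtermValues h (ts i))).symm

theorem HomOn.eval_comp {ρ : J.Carrier → J'.Carrier} (hρ : J.HomOn J' Set.univ ρ)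
    (h : J.Valuation) (t : L.Term ℕ) : J'.eval (ρ ∘ h) t = ρ (J.eval h t) :=
  (hρ.mono (Set.subset_univ _)).eval_eq fun _ _ => rfl

theorem eval_congr {h h' : J.Valuation} {t : L.Term ℕ} (hh : ∀ x ∈ t.varFinset, h' x = h x) :
    J.eval h' t = J.eval h t :=
  HomOn.eval_eq (ρ := id) (fun _ _ _ _ _ => rfl) hh

/-- `c` is an immediate constituent of `d`: some function symbol takes the value `d` on a tuple
that contains `c`. -/
def Child (J : PreInterpretation.{u, v, w} L) (c d : J.Carrier) : Prop :=
  ∃ (n : ℕ) (f : L.Functions n) (x : Fin n → J.Carrier), J.fn f x = d ∧ ∃ i, x i = c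

theorem child_fn {n : ℕ} (f : L.Functions n) (x : Fin n → J.Carrier) (i : Fin n) :
    J.Child (x i) (J.fn f x) :=
  ⟨n, f, x, rfl, i, rfl⟩

theorem HomOn.map_child {ρ : J.Carrier → J'.Carrier} (hρ : J.HomOn J' Set.univ ρ)
    {c d : J.Carrier} (h : J.Child c d) : J'.Child (ρ c) (ρ d) := by
  obtain ⟨n, f, x, rfl, i, rfl⟩ := h
  rw [hρ.map_fn]
  exact child_fn f (ρ ∘ x) i

theorem reflTransGen_child_eval (h : J.Valuation) {x : ℕ} {t : L.Term ℕ}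
    (hx : x ∈ t.varFinset) : ReflTransGen J.Child (h x) (J.eval h t) := by
  induction t with
  | var y =>
    obtain rfl : x = y := by simpa [Language.Term.varFinset] using hx
    exact .refl
  | func f ts ih =>
    obtain ⟨i, hi⟩ := mem_varFinset_func.1 hx
    exact (ih i hi).tail (child_fn f (fun i => J.eval h (ts i)) i)

theorem transGen_child_eval (h : J.Valuation) {x : ℕ} {t : L.Term ℕ} (hx : x ∈ t.varFinset)
    (ht : t ≠ .var x) : TransGen J.Child (h x) (J.eval h t) := by
  cases t with
  | var y =>
    obtain rfl : x = y := by simpa [Language.Term.varFinset] using hx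
    exact absurd rfl ht
  | func f ts =>
    obtain ⟨i, hi⟩ := mem_varFinset_func.1 hx
    exact .tail' (reflTransGen_child_eval h hi) (child_fn f (fun i => J.eval h (ts i)) i)

theorem exists_eval_func_eq_of_child (h : J.Valuation) (t : L.Term ℕ) {d : J.Carrier}
    (hd : J.Child (J.eval h t) d) :
    ∃ (h' : J.Valuation) (n : ℕ) (f : L.Functions n) (ts : Fin n → L.Term ℕ) (i : Fin n),
      (∀ x ∈ t.varFinset, h' x = h x) ∧ ts i = t ∧ J.eval h' (.func f ts) = d := by
  obtain ⟨n, f, y, rfl, i, hi⟩ := hd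
  -- The arguments of `f` other than `t` become variables `N + j` that are fresh for `t`.
  let N := t.varFinset.sup id + 1
  let h' : J.Valuation := fun x =>
    if hx : N ≤ x ∧ x - N < n then y ⟨x - N, hx.2⟩ else h x
  have hagree : ∀ x ∈ t.varFinset, h' x = h x := fun x hx =>
    dif_neg fun hN => (Nat.lt_succ_of_le (Finset.le_sup (f := id) hx)).not_ge hN.1
  refine ⟨h', n, f, fun j => if j = i then t else .var (N + j), i, hagree, if_pos rfl, ?_⟩
  refine congrArg (J.fn f) (funext fun j => ?_)
  by_cases hj : j = i
  · simp only [hj, if_true, hi]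
    exact eval_congr hagree
  · simp [hj, eval, h']

theorem exists_eval_eq_of_transGen_child {c d : J.Carrier} (hcd : TransGen J.Child c d) :
    ∃ (h : J.Valuation) (x : ℕ) (t : L.Term ℕ),
      x ∈ t.varFinset ∧ t ≠ .var x ∧ h x = c ∧ J.eval h t = d := by
  suffices hstep : ∀ {b} (h : J.Valuation) (x : ℕ) (t : L.Term ℕ), x ∈ t.varFinset → h x = c →
      J.Child (J.eval h t) b → ∃ (h : J.Valuation) (x : ℕ) (t : L.Term ℕ),
        x ∈ t.varFinset ∧ t ≠ .var x ∧ h x = c ∧ J.eval h t = b by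
    induction hcd with
    | single hc => exact hstep (fun _ => c) 0 (.var 0) (by simp [Language.Term.varFinset]) rfl hc
    | tail _ hc ih =>
      obtain ⟨h, x, t, hx, -, hhx, rfl⟩ := ih
      exact hstep h x t hx hhx hc
  intro b h x t hx hhx hb
  obtain ⟨h', n, f, ts, i, hagree, rfl, rfl⟩ := exists_eval_func_eq_of_child h t hb
  exact ⟨h', x, .func f ts, mem_varFinset_func.2 ⟨i, hx⟩, by simp, (hagree x hx).trans hhx, rfl⟩

theorem ModelsFEA.not_transGen_child_self (hJ : J.ModelsFEA) (c : J.Carrier) :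
    ¬ TransGen J.Child c c := by
  intro hc
  obtain ⟨h, x, t, hx, ht, hhx, hht⟩ := exists_eval_eq_of_transGen_child hc
  exact hJ.acyclic x t ht hx h (hhx.trans hht.symm)

theorem ModelsFEA.wellFoundedOn_child (hJ : J.ModelsFEA) {V : Set J.Carrier} (hV : V.Finite) :
    V.WellFoundedOn J.Child := by
  have : IsStrictOrder J.Carrier (TransGen J.Child) :=
    { irrefl := hJ.not_transGen_child_self, trans := fun _ _ _ => TransGen.trans }
  have hwf : V.WellFoundedOn (TransGen J.Child) := hV.wellFoundedOn
  exact hwf.mono' fun _ _ _ _ => TransGen.single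

theorem ModelsFEA.eq_of_fn_eq_fn (hJ : J.ModelsFEA) {n m : ℕ} {f : L.Functions n}
    {g : L.Functions m} {x : Fin n → J.Carrier} {y : Fin m → J.Carrier}
    (h : J.fn f x = J.fn g y) :
    (⟨n, f, x⟩ : Σ k, L.Functions k × (Fin k → J.Carrier)) = ⟨m, g, y⟩ := by
  have hfg : (⟨n, f⟩ : Σ k, L.Functions k) = ⟨m, g⟩ :=
    by_contra fun hne => hJ.disjoint f g hne x y h
  cases hfg
  obtain rfl : x = y := funext ((hJ.injective f x y).1 h)
  rfl

theorem modelsFEA_of_injective_of_not_transGen_child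
    (hinj : Injective fun z : Σ k, L.Functions k × (Fin k → J.Carrier) => J.fn z.2.1 z.2.2)
    (hirr : ∀ c, ¬ TransGen J.Child c c) : J.ModelsFEA where
  injective f x y := by
    refine ⟨fun h i => ?_, fun h => congrArg (J.fn f) (funext h)⟩
    cases hinj (a₁ := ⟨_, f, x⟩) (a₂ := ⟨_, f, y⟩) h
    rfl
  disjoint f g hne x y h := by
    cases hinj (a₁ := ⟨_, f, x⟩) (a₂ := ⟨_, g, y⟩) h
    exact hne rfl
  acyclic x t ht hx h he := hirr (h x) (he ▸ transGen_child_eval h hx ht)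

/-- An element outside the ranges of all function symbols. -/
def Indecomposable (J : PreInterpretation.{u, v, w} L) (d : J.Carrier) : Prop :=
  ∀ ⦃n : ℕ⦄ (f : L.Functions n) (x : Fin n → J.Carrier), J.fn f x ≠ d

theorem ModelsFEA.exists_homOn (hJ : J.ModelsFEA) {V : Set J.Carrier}
    (hV : V.WellFoundedOn J.Child) (α : J.Carrier → J'.Carrier) :
    ∃ ρ : J.Carrier → J'.Carrier, J.HomOn J' V ρ ∧ ∀ d, J.Indecomposable d → ρ d = α d := by
  classical
  rw [Set.wellFoundedOn_iff] at hV
  let Decomposes (d : J.Carrier) (z : Σ k, L.Functions k × (Fin k → J.Carrier)) : Prop :=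
    J.fn z.2.1 z.2.2 = d ∧ d ∈ V ∧ ∀ i, z.2.2 i ∈ V
  have hchild {d z} (hz : Decomposes d z) (i) : J.Child (z.2.2 i) d ∧ z.2.2 i ∈ V ∧ d ∈ V :=
    ⟨hz.1 ▸ child_fn z.2.1 z.2.2 i, hz.2.2 i, hz.2.1⟩
  let F (d : J.Carrier) (ih : ∀ c, J.Child c d ∧ c ∈ V ∧ d ∈ V → J'.Carrier) : J'.Carrier :=
    if hd : ∃ z, Decomposes d z then
      J'.fn hd.choose.2.1 fun i => ih (hd.choose.2.2 i) (hchild hd.choose_spec i)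
    else α d
  refine ⟨hV.fix F, fun n f x hf hx => ?_, fun d hd => ?_⟩
  · have hd : ∃ z, Decomposes (J.fn f x) z := ⟨⟨n, f, x⟩, rfl, hf, hx⟩
    have hchoose : hd.choose = ⟨n, f, x⟩ := hJ.eq_of_fn_eq_fn hd.choose_spec.1
    rw [hV.fix_eq]
    calc F (J.fn f x) (fun c _ => hV.fix F c)
        = J'.fn hd.choose.2.1 (hV.fix F ∘ hd.choose.2.2) := dif_pos hd
      _ = J'.fn f (hV.fix F ∘ x) := by rw [hchoose]
  · rw [hV.fix_eq]
    exact dif_neg fun ⟨z, hz⟩ => hd _ _ hz.1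

/-- The product of two pre-interpretations. -/
abbrev prod (J₁ : PreInterpretation.{u, v, w₁} L) (J₂ : PreInterpretation.{u, v, w₂} L) :
    PreInterpretation.{u, v, max w₁ w₂} L where
  Carrier := J₁.Carrier × J₂.Carrier
  nonempty := haveI := J₁.nonempty; haveI := J₂.nonempty; inferInstance
  fn f x := (J₁.fn f fun i => (x i).1, J₂.fn f fun i => (x i).2)

section Prod

variable {J₁ : PreInterpretation.{u, v, w₁} L} {J₂ : PreInterpretation.{u, v, w₂} L}

theorem homOn_fst : (J₁.prod J₂).HomOn J₁ Set.univ Prod.fst := fun _ _ _ _ _ => rfl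

theorem homOn_snd : (J₁.prod J₂).HomOn J₂ Set.univ Prod.snd := fun _ _ _ _ _ => rfl

theorem wellFounded_child_prod (hw : WellFounded J₁.Child) :
    WellFounded (J₁.prod J₂).Child :=
  Subrelation.wf homOn_fst.map_child (InvImage.wf Prod.fst hw)

theorem ModelsFEA.prod (h₁ : J₁.ModelsFEA) (h₂ : J₂.ModelsFEA) : (J₁.prod J₂).ModelsFEA := by
  refine modelsFEA_of_injective_of_not_transGen_child ?_ fun c hc => ?_
  · rintro ⟨n, f, x⟩ ⟨m, g, y⟩ h
    have hfst := h₁.eq_of_fn_eq_fn (congrArg Prod.fst h)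
    have hsnd := h₂.eq_of_fn_eq_fn (congrArg Prod.snd h)
    cases congrArg Sigma.fst hfst
    simp only [Sigma.mk.injEq, heq_eq_eq, true_and, Prod.mk.injEq] at hfst hsnd
    obtain ⟨rfl, hx⟩ := hfst
    have hxy : x = y := funext fun i => Prod.ext (congrFun hx i) (congrFun hsnd.2 i)
    rw [hxy]
  · exact h₁.not_transGen_child_self c.1 (hc.lift Prod.fst fun _ _ => homOn_fst.map_child)

end Prod

/-- A copy in the universe `w` of the function symbols of `L`. -/
def shrinkFunctions (L : FirstOrder.Language.{u, v}) [∀ n, Small.{w} (L.Functions n)] :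
    FirstOrder.Language.{w, 0} :=
  ⟨fun n => Shrink.{w} (L.Functions n), fun _ => Empty⟩

/-- The pre-interpretation of `L` by its terms in the variables `ℕ`. The terms are built over
`shrinkFunctions L` because `L` may live in a larger universe than the domains considered. -/
noncomputable def termModel (L : FirstOrder.Language.{u, v})
    [∀ n, Small.{w} (L.Functions n)] : PreInterpretation.{u, v, w} L where
  Carrier := (shrinkFunctions.{u, v, w} L).Term ℕ
  nonempty := ⟨.var 0⟩
  fn {n} f x := .func (L := shrinkFunctions.{u, v, w} L) (equivShrink (L.Functions n) f) x

theorem ModelsFEA.small_functions (hJ : J.ModelsFEA) (n : ℕ) : Small.{w} (L.Functions n) := by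
  have := J.nonempty
  refine small_of_injective
    (f := fun f : L.Functions n => J.fn f fun _ => Classical.arbitrary _) fun f g hfg => ?_
  cases hJ.eq_of_fn_eq_fn hfg
  rfl

section TermModel

variable [∀ n, Small.{w} (L.Functions n)]

theorem wellFounded_child_termModel : WellFounded (termModel.{u, v, w} L).Child := by
  refine ⟨fun (t : (shrinkFunctions.{u, v, w} L).Term ℕ) => ?_⟩
  induction t with
  | var x =>
    refine ⟨_, ?_⟩
    rintro _ ⟨n, f, y, h, -⟩
    cases h
  | func g ts ih =>
    refine ⟨_, ?_⟩
    rintro _ ⟨n, f, y, h, i, rfl⟩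
    cases h
    exact ih i

theorem modelsFEA_termModel : (termModel.{u, v, w} L).ModelsFEA := by
  refine modelsFEA_of_injective_of_not_transGen_child ?_
    wellFounded_child_termModel.transGen.irrefl.irrefl
  rintro ⟨n, f, x⟩ ⟨m, g, y⟩ h
  obtain ⟨hnm, hfg, hxy⟩ := Language.Term.func.inj h
  obtain rfl : n = m := hnm
  obtain rfl : f = g := (equivShrink (L.Functions n)).injective (eq_of_heq hfg)
  obtain rfl : x = y := eq_of_heq hxy
  rfl

theorem indecomposable_var (x : ℕ) :
    (termModel.{u, v, w} L).Indecomposable (Language.Term.var x) :=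
  fun _ _ _ h => by cases h

end TermModel

/-- A route to a constituent, read from the outside: at each step a function symbol and the
position of one of its arguments. -/
abbrev Path (L : FirstOrder.Language.{u, v}) : Type u := List (Σ n, L.Functions n × Fin n)

/-- `e` is the constituent of `d` that the path leads to; in a model of the free equality axioms
it is determined by `d` and the path. -/
def ConstituentAt (J : PreInterpretation.{u, v, w} L) :
    Path L → J.Carrier → J.Carrier → Prop
  | [], d, e => d = e
  | ⟨_, f, i⟩ :: p, d, e => ∃ x, J.fn f x = d ∧ ConstituentAt J p (x i) e

theorem constituentAt_append {p q : Path L} {d e : J.Carrier} :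
    J.ConstituentAt (p ++ q) d e ↔ ∃ c, J.ConstituentAt p d c ∧ J.ConstituentAt q c e := by
  induction p generalizing d with
  | nil => simp [ConstituentAt]
  | cons a p ih => simp only [List.cons_append, ConstituentAt, ih]; tauto

theorem ModelsFEA.constituentAt_unique (hJ : J.ModelsFEA) {p : Path L} {d e e' : J.Carrier}
    (h : J.ConstituentAt p d e) (h' : J.ConstituentAt p d e') : e = e' := by
  induction p generalizing d with
  | nil => exact Eq.trans (Eq.symm h) h'
  | cons a p ih =>
    obtain ⟨x, rfl, hx⟩ := h
    obtain ⟨y, hyx, hy⟩ := h'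
    exact ih hx ((hJ.injective a.2.1 y x).1 hyx a.2.2 ▸ hy)

theorem HomOn.map_constituentAt {ρ : J.Carrier → J'.Carrier} (hρ : J.HomOn J' Set.univ ρ)
    {p : Path L} {d e : J.Carrier} (h : J.ConstituentAt p d e) :
    J'.ConstituentAt p (ρ d) (ρ e) := by
  induction p generalizing d with
  | nil => exact congrArg ρ h
  | cons a p ih =>
    obtain ⟨x, rfl, hx⟩ := h
    exact ⟨ρ ∘ x, (hρ.map_fn a.2.1 x).symm, ih hx⟩

theorem Indecomposable.constituentAt_iff {d e : J.Carrier} (hd : J.Indecomposable d)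
    {p : Path L} : J.ConstituentAt p d e ↔ p = [] ∧ d = e := by
  cases p with
  | nil => simp [ConstituentAt]
  | cons a p => simp [ConstituentAt, hd a.2.1]

theorem ModelsFEA.finite_setOf_constituentAt (hJ : J.ModelsFEA) (hw : WellFounded J.Child)
    (d : J.Carrier) : {p | ∃ e, J.ConstituentAt p d e}.Finite := by
  induction d using hw.induction with
  | _ d ih =>
    by_cases hd : J.Indecomposable d
    · refine (Set.finite_singleton []).subset ?_
      rintro p ⟨e, he⟩
      exact (hd.constituentAt_iff.1 he).1
    · simp only [Indecomposable, not_forall, not_not] at hd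
      obtain ⟨n, f, x, rfl⟩ := hd
      have hargs : (⋃ i : Fin n,
          List.cons ⟨n, f, i⟩ '' {p | ∃ e, J.ConstituentAt p (x i) e}).Finite :=
        Set.finite_iUnion fun i => (ih (x i) (child_fn f x i)).image _
      refine (hargs.insert []).subset ?_
      rintro (_ | ⟨⟨m, g, i⟩, p⟩) ⟨e, he⟩
      · exact Set.mem_insert _ _
      · obtain ⟨y, hyx, hy⟩ := he
        cases hJ.eq_of_fn_eq_fn hyx
        exact .inr (Set.mem_iUnion.2 ⟨i, p, ⟨e, hy⟩, rfl⟩)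

end PreInterpretation

open PreInterpretation

/-- A place inside the members of a family indexed by `ι`: an index and a path. -/
abbrev Position (L : FirstOrder.Language.{u, v}) (ι : Type*) := ι × Path L

/-- An atomic condition on a family of elements: two positions carry the same constituent, or
the constituent at a position is a value of a given function symbol. -/
inductive PathConstraint (L : FirstOrder.Language.{u, v}) (ι : Type*)
  | eq (a b : Position L ι)
  | head (a : Position L ι) (f : Σ n, L.Functions n)

namespace PreInterpretation

variable {L : FirstOrder.Language.{u, v}} {J : PreInterpretation.{u, v, w} L}
  {J' : PreInterpretation.{u, v, w'} L} {ι : Type*}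

/-- The family `g` has the constituent `e` at the position `a`. -/
def ValueAt (J : PreInterpretation.{u, v, w} L) (g : ι → J.Carrier) (a : Position L ι)
    (e : J.Carrier) : Prop :=
  J.ConstituentAt a.2 (g a.1) e

/-- Truth of a path constraint for a family; it includes the existence of the constituents at the
positions mentioned. -/
def Satisfies (J : PreInterpretation.{u, v, w} L) (g : ι → J.Carrier) :
    PathConstraint L ι → Prop
  | .eq a b => ∃ e, J.ValueAt g a e ∧ J.ValueAt g b e
  | .head a f => ∃ x, J.ValueAt g a (J.fn f.2 x)

/-- The set of all path constraints true of a family. -/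
def pathType (J : PreInterpretation.{u, v, w} L) (g : ι → J.Carrier) : Set (PathConstraint L ι) :=
  {c | J.Satisfies g c}

theorem HomOn.pathType_subset {ρ : J.Carrier → J'.Carrier} (hρ : J.HomOn J' Set.univ ρ)
    (g : ι → J.Carrier) : J.pathType g ⊆ J'.pathType (ρ ∘ g) := by
  rintro (⟨a, b⟩ | ⟨a, f⟩) h
  · obtain ⟨e, ha, hb⟩ := h
    exact ⟨ρ e, hρ.map_constituentAt ha, hρ.map_constituentAt hb⟩
  · obtain ⟨x, ha⟩ := h
    exact ⟨ρ ∘ x, hρ.map_fn f.2 x ▸ hρ.map_constituentAt ha⟩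

theorem ModelsFEA.exists_forall_valueAt (hJ' : J'.ModelsFEA) {g : ι → J.Carrier}
    {r : ι → J'.Carrier} (hgr : J.pathType g ⊆ J'.pathType r) (d : J.Carrier) :
    ∃ e, ∀ a, J.ValueAt g a d → J'.ValueAt r a e := by
  by_cases hd : ∃ a, J.ValueAt g a d
  · obtain ⟨a, ha⟩ := hd
    obtain ⟨e, hae, -⟩ := hgr (show PathConstraint.eq a a ∈ J.pathType g from ⟨d, ha, ha⟩)
    refine ⟨e, fun b hb => ?_⟩
    obtain ⟨e', hae', hbe'⟩ := hgr (show PathConstraint.eq a b ∈ J.pathType g from ⟨d, ha, hb⟩)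
    exact hJ'.constituentAt_unique hae hae' ▸ hbe'
  · exact ⟨Classical.choice J'.nonempty, fun a ha => absurd ⟨a, ha⟩ hd⟩

theorem ModelsFEA.exists_homOn_of_pathType_subset (hJ : J.ModelsFEA) (hw : WellFounded J.Child)
    (hJ' : J'.ModelsFEA) {g : ι → J.Carrier} {r : ι → J'.Carrier}
    (hgr : J.pathType g ⊆ J'.pathType r) : ∃ ρ, J.HomOn J' Set.univ ρ ∧ ρ ∘ g = r := by
  choose α hα using hJ'.exists_forall_valueAt hgr
  obtain ⟨ρ, hρ, hρα⟩ := hJ.exists_homOn (V := Set.univ) hw.wellFoundedOn α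
  have hvalue : ∀ d a, J.ValueAt g a d → J'.ValueAt r a (ρ d) := fun d => by
    induction d using hw.induction with
    | _ d ih =>
      intro a ha
      by_cases hd : J.Indecomposable d
      · exact hρα d hd ▸ hα d a ha
      · simp only [Indecomposable, not_forall, not_not] at hd
        obtain ⟨n, f, x, rfl⟩ := hd
        obtain ⟨y, hy⟩ := hgr (show PathConstraint.head a ⟨n, f⟩ ∈ J.pathType g from ⟨x, ha⟩)
        have hyx : y = ρ ∘ x := funext fun i => by
          let ai : Position L ι := (a.1, a.2 ++ [⟨n, f, i⟩])
          have hxi : J'.ValueAt r ai (ρ (x i)) := ih (x i) (child_fn f x i) ai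
            (constituentAt_append.2 ⟨_, ha, x, rfl, rfl⟩)
          have hyi : J'.ValueAt r ai (y i) := constituentAt_append.2 ⟨_, hy, y, rfl, rfl⟩
          exact hJ'.constituentAt_unique hyi hxi
        exact hρ.map_fn f x ▸ hyx ▸ hy
  exact ⟨ρ, hρ, funext fun i => (hvalue (g i) (i, []) rfl).symm⟩

end PreInterpretation

/-- The constraints that every family satisfies because its members exist. -/
def trivialConstraints (L : FirstOrder.Language.{u, v}) (ι : Type*) : Set (PathConstraint L ι) :=
  Set.range fun i => .eq (i, []) (i, [])

namespace PreInterpretation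

variable {L : FirstOrder.Language.{u, v}} {J : PreInterpretation.{u, v, w} L} {ι : Type*}

theorem trivialConstraints_subset_pathType (g : ι → J.Carrier) :
    trivialConstraints L ι ⊆ J.pathType g := by
  rintro _ ⟨i, rfl⟩
  exact ⟨g i, rfl, rfl⟩

theorem ModelsFEA.finite_setOf_mem_and_valueAt (hJ : J.ModelsFEA) (hw : WellFounded J.Child)
    (s : ι → J.Carrier) {F : Set ι} (hF : F.Finite) :
    {a : Position L ι | a.1 ∈ F ∧ ∃ e, J.ValueAt s a e}.Finite := by
  refine (hF.biUnion fun i _ =>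
    (hJ.finite_setOf_constituentAt hw (s i)).image (Prod.mk i)).subset ?_
  rintro ⟨i, p⟩ ⟨hi, hp⟩
  exact Set.mem_biUnion hi ⟨p, hp, rfl⟩

section FiniteExceptions

variable {s : ι → J.Carrier} {F : Set ι}

theorem eq_of_valueAt_of_indecomposable (hs : ∀ i ∉ F, J.Indecomposable (s i))
    {a : Position L ι} {e : J.Carrier} (ha : a.1 ∉ F) (hae : J.ValueAt s a e) :
    a = (a.1, []) ∧ s a.1 = e := by
  obtain ⟨hpath, he⟩ := (hs a.1 ha).constituentAt_iff.1 hae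
  exact ⟨Prod.ext rfl hpath, he⟩

theorem ModelsFEA.finite_setOf_valueAt (hJ : J.ModelsFEA) (hw : WellFounded J.Child)
    (hF : F.Finite) (hs : ∀ i ∉ F, J.Indecomposable (s i)) (hinj : Set.InjOn s Fᶜ)
    (e : J.Carrier) : {b | J.ValueAt s b e}.Finite := by
  have hvar : {i | i ∉ F ∧ s i = e}.Subsingleton := fun i hi j hj =>
    hinj hi.1 hj.1 (hi.2.trans hj.2.symm)
  refine ((hJ.finite_setOf_mem_and_valueAt hw s hF).union
    (hvar.finite.image fun i => (i, []))).subset fun b hb => ?_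
  by_cases hbF : b.1 ∈ F
  · exact .inl ⟨hbF, e, hb⟩
  · obtain ⟨hpath, he⟩ := eq_of_valueAt_of_indecomposable hs hbF hb
    exact .inr ⟨b.1, ⟨hbF, he⟩, hpath.symm⟩

theorem mem_of_eq_mem_pathType (hs : ∀ i ∉ F, J.Indecomposable (s i))
    (hinj : Set.InjOn s Fᶜ) {a b : Position L ι} (h : .eq a b ∈ J.pathType s)
    (hab : .eq a b ∉ trivialConstraints L ι) : a.1 ∈ F ∨ b.1 ∈ F := by
  by_contra! hF
  obtain ⟨e, hae, hbe⟩ := h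
  obtain ⟨ha, hea⟩ := eq_of_valueAt_of_indecomposable hs hF.1 hae
  obtain ⟨hb, heb⟩ := eq_of_valueAt_of_indecomposable hs hF.2 hbe
  have hidx : a.1 = b.1 := hinj hF.1 hF.2 (hea.trans heb.symm)
  refine hab ⟨a.1, ?_⟩
  rw [ha, hb, hidx]

theorem mem_of_head_mem_pathType (hs : ∀ i ∉ F, J.Indecomposable (s i))
    {a : Position L ι} {f : Σ n, L.Functions n} (h : .head a f ∈ J.pathType s) : a.1 ∈ F := by
  by_contra hF
  obtain ⟨x, hx⟩ := h
  exact hs a.1 hF f.2 x (eq_of_valueAt_of_indecomposable hs hF hx).2.symm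

theorem ModelsFEA.finite_pathType_diff_trivialConstraints (hJ : J.ModelsFEA)
    (hw : WellFounded J.Child) (hF : F.Finite) (hs : ∀ i ∉ F, J.Indecomposable (s i))
    (hinj : Set.InjOn s Fᶜ) : (J.pathType s \ trivialConstraints L ι).Finite := by
  let inner : Set (Position L ι) := {a | a.1 ∈ F ∧ ∃ e, J.ValueAt s a e}
  let partners (a : Position L ι) : Set (Position L ι) := {b | .eq a b ∈ J.pathType s}
  let heads (a : Position L ι) : Set (Σ n, L.Functions n) := {f | .head a f ∈ J.pathType s}
  have hpartners : ∀ a ∈ inner, (partners a).Finite := by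
    rintro a ⟨-, e, hae⟩
    refine (hJ.finite_setOf_valueAt hw hF hs hinj e).subset ?_
    rintro b ⟨e', hae', hbe'⟩
    exact hJ.constituentAt_unique hae' hae ▸ hbe'
  have hheads : ∀ a ∈ inner, (heads a).Finite := fun a _ =>
    Set.Subsingleton.finite <| by
      rintro ⟨n, f⟩ ⟨x, hx⟩ ⟨m, g⟩ ⟨y, hy⟩
      cases hJ.eq_of_fn_eq_fn (hJ.constituentAt_unique hx hy)
      rfl
  have hinner : inner.Finite := hJ.finite_setOf_mem_and_valueAt hw s hF
  refine (hinner.biUnion fun a ha => (((hpartners a ha).image (PathConstraint.eq a)).union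
    ((hpartners a ha).image (PathConstraint.eq · a))).union
    ((hheads a ha).image (PathConstraint.head a))).subset ?_
  rintro (⟨a, b⟩ | ⟨a, f⟩) ⟨hc, hnontrivial⟩
  · have ⟨e, hae, hbe⟩ := hc
    obtain ha | hb := mem_of_eq_mem_pathType hs hinj hc hnontrivial
    · exact Set.mem_biUnion (⟨ha, e, hae⟩ : a ∈ inner) (.inl (.inl ⟨b, hc, rfl⟩))
    · exact Set.mem_biUnion (⟨hb, e, hbe⟩ : b ∈ inner) (.inl (.inr ⟨a, ⟨e, hbe, hae⟩, rfl⟩))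
  · have ⟨x, hx⟩ := hc
    exact Set.mem_biUnion (⟨mem_of_head_mem_pathType hs hc, _, hx⟩ : a ∈ inner)
      (.inr ⟨f, hc, rfl⟩)

end FiniteExceptions

end PreInterpretation

/-- A class of families indexed by `ι`, given by a set of families in each pre-interpretation;
it plays the role of a relation of possibly infinite arity definable in all of them. -/
abbrev FamilyClass (L : FirstOrder.Language.{u, v}) (ι : Type*) :=
  ∀ J : PreInterpretation.{u, v, w} L, Set (ι → J.Carrier)

namespace FamilyClass

variable {L : FirstOrder.Language.{u, v}} {ι : Type*} {R R' : FamilyClass.{u, v, w} L ι}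

/-- Closure under homomorphic images. -/
def HomClosed (R : FamilyClass.{u, v, w} L ι) : Prop :=
  ∀ ⦃J J' : PreInterpretation.{u, v, w} L⦄ ⦃ρ : J.Carrier → J'.Carrier⦄,
    J.HomOn J' Set.univ ρ → ∀ g ∈ R J, ρ ∘ g ∈ R J'

/-- Closure under componentwise pairing in the product of two pre-interpretations. -/
def ProdClosed (R : FamilyClass.{u, v, w} L ι) : Prop :=
  ∀ ⦃J₁ J₂ : PreInterpretation.{u, v, w} L⦄, ∀ g₁ ∈ R J₁, ∀ g₂ ∈ R J₂,
    (fun i => (g₁ i, g₂ i)) ∈ R (J₁.prod J₂)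

/-- The path constraints that hold throughout a class, in all models of the free equality
axioms. -/
def theory (R : FamilyClass.{u, v, w} L ι) : Set (PathConstraint L ι) :=
  {c | ∀ J : PreInterpretation.{u, v, w} L, J.ModelsFEA → ∀ g ∈ R J, c ∈ J.pathType g}

theorem theory_subset_pathType {J : PreInterpretation.{u, v, w} L} (hJ : J.ModelsFEA)
    {g : ι → J.Carrier} (hg : g ∈ R J) : R.theory ⊆ J.pathType g :=
  fun _ hc => hc J hJ g hg

theorem trivialConstraints_subset_theory : trivialConstraints L ι ⊆ R.theory :=
  fun _ hc _ _ g _ => trivialConstraints_subset_pathType g hc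

section Theory

variable {T : PreInterpretation.{u, v, w} L} {s : ι → T.Carrier}

theorem ProdClosed.exists_pathType_subset_diff (hR : R.ProdClosed) (hT : T.ModelsFEA)
    (hw : WellFounded T.Child) (hs : s ∈ R T) {C : Set (PathConstraint L ι)} (hC : C.Finite)
    (hCR : Disjoint C R.theory) :
    ∃ P : PreInterpretation.{u, v, w} L, P.ModelsFEA ∧ WellFounded P.Child ∧
      ∃ g ∈ R P, P.pathType g ⊆ T.pathType s \ C := by
  induction C, hC using Set.Finite.induction_on with
  | empty => exact ⟨T, hT, hw, s, hs, by simp⟩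
  | @insert c C _ _ ih =>
    obtain ⟨hc, hCR⟩ := Set.disjoint_insert_left.1 hCR
    obtain ⟨P, hP, hPw, g, hg, hgs⟩ := ih hCR
    obtain ⟨J, hJ, r, hr, hcr⟩ :
        ∃ J : PreInterpretation.{u, v, w} L, J.ModelsFEA ∧ ∃ r ∈ R J, c ∉ J.pathType r := by
      simpa [theory] using hc
    have hsub₁ := homOn_fst.pathType_subset (J := P.prod J) fun i => (g i, r i)
    have hsub₂ := homOn_snd.pathType_subset (J := P.prod J) fun i => (g i, r i)
    refine ⟨P.prod J, hP.prod hJ, wellFounded_child_prod hPw, _, hR g hg r hr, fun c' hc' => ?_⟩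
    refine ⟨(hgs (hsub₁ hc')).1, ?_⟩
    rintro (rfl | hc'C)
    · exact hcr (hsub₂ hc')
    · exact (hgs (hsub₁ hc')).2 hc'C

variable (hT : T.ModelsFEA) (hfin : (T.pathType s \ trivialConstraints L ι).Finite)

include hT hfin

theorem ProdClosed.exists_pathType_subset_theory (hR : R.ProdClosed) (hw : WellFounded T.Child)
    (hs : s ∈ R T) :
    ∃ P : PreInterpretation.{u, v, w} L, P.ModelsFEA ∧ WellFounded P.Child ∧
      ∃ g ∈ R P, P.pathType g ⊆ R.theory := by
  have hfin' : (T.pathType s \ R.theory).Finite :=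
    hfin.subset (Set.sdiff_subset_sdiff_right trivialConstraints_subset_theory)
  simpa only [Set.sdiff_sdiff_right_self, Set.inter_eq_right.2 (theory_subset_pathType hT hs)]
    using hR.exists_pathType_subset_diff hT hw hs hfin' disjoint_sdiff_self_left

theorem subset_of_theory_subset (hhom : R'.HomClosed) (hprod : R'.ProdClosed)
    (hw : WellFounded T.Child) (hs : s ∈ R' T) (hRR' : R'.theory ⊆ R.theory)
    {J : PreInterpretation.{u, v, w} L} (hJ : J.ModelsFEA) : R J ⊆ R' J := by
  intro r hr
  obtain ⟨P, hP, hPw, g, hg, hgR'⟩ := hprod.exists_pathType_subset_theory hT hfin hw hs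
  obtain ⟨ρ, hρ, rfl⟩ := hP.exists_homOn_of_pathType_subset hPw hJ
    (hgR'.trans (hRR'.trans (theory_subset_pathType hJ hr)))
  exact hhom hρ g hg

theorem finite_theories : (theory '' {R : FamilyClass.{u, v, w} L ι | s ∈ R T}).Finite := by
  refine (hfin.finite_subsets.image (· ∪ trivialConstraints L ι)).subset ?_
  rintro _ ⟨R, hs, rfl⟩
  exact ⟨R.theory \ trivialConstraints L ι,
    Set.sdiff_subset_sdiff_left (theory_subset_pathType hT hs),
    Set.sdiff_union_of_subset trivialConstraints_subset_theory⟩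

end Theory

end FamilyClass

namespace PreInterpretation

variable {L : FirstOrder.Language.{u, v}} {J : PreInterpretation.{u, v, w} L}
  {J' : PreInterpretation.{u, v, w'} L}

/-- The predicate symbol of a generalized atom. -/
def symbol (A : J.Base) : Σ n, L.Relations n := ⟨A.1, A.2.1⟩

/-- The image of a generalized atom under a map of the domains. -/
def mapBase (ρ : J.Carrier → J'.Carrier) (A : J.Base) : J'.Base := ⟨A.1, A.2.1, ρ ∘ A.2.2⟩

theorem exists_eq_of_symbol_eq {A : J.Base} {p : Σ n, L.Relations n} (h : symbol A = p) :
    ∃ x : Fin p.1 → J.Carrier, (⟨p.1, p.2, x⟩ : J.Base) = A := by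
  subst h
  exact ⟨A.2.2, rfl⟩

theorem prod_base_ext {J₁ : PreInterpretation.{u, v, w₁} L}
    {J₂ : PreInterpretation.{u, v, w₂} L} {A B : (J₁.prod J₂).Base}
    (h₁ : mapBase Prod.fst A = mapBase Prod.fst B)
    (h₂ : mapBase Prod.snd A = mapBase Prod.snd B) : A = B := by
  obtain ⟨n, p, x⟩ := A
  obtain ⟨m, q, y⟩ := B
  cases congrArg Sigma.fst h₁
  simp only [mapBase, Sigma.mk.injEq, heq_eq_eq, true_and, Prod.mk.injEq] at h₁ h₂
  obtain ⟨rfl, hfst⟩ := h₁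
  have hxy : x = y := funext fun i => Prod.ext (congrFun hfst i) (congrFun h₂.2 i)
  rw [hxy]

end PreInterpretation

namespace Query

variable {L : FirstOrder.Language.{u, v}} {J : PreInterpretation.{u, v, w} L}
  {J' : PreInterpretation.{u, v, w'} L} {Q Q' : Query L}

/-- The predicate symbols of the atoms of a query, in the order of their occurrence. -/
def symbols : Query L → List (Σ n, L.Relations n)
  | tru => []
  | fls => []
  | eq _ _ => []
  | atom p _ => [⟨_, p⟩]
  | and Q₁ Q₂ => Q₁.symbols ++ Q₂.symbols
  | ex _ Q => Q.symbols

theorem length_symbols (Q : Query L) : Q.symbols.length = Q.card := by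
  induction Q <;> simp_all [symbols, card]

/-- `h` solves `Q`, and `As` lists the generalized atoms whose truth this requires, one for each
occurrence of an atom; thus `As` is the least multiinterpretation of which `h` is a solution. -/
def Solves (J : PreInterpretation.{u, v, w} L) : Query L → List J.Base → J.Valuation → Prop
  | tru, As, _ => As = []
  | fls, _, _ => False
  | eq s t, As, h => As = [] ∧ J.eval h s = J.eval h t
  | atom p ts, As, h => As = [⟨_, p, fun i => J.eval h (ts i)⟩]
  | and Q₁ Q₂, As, h => ∃ As₁ As₂, As = As₁ ++ As₂ ∧ Solves J Q₁ As₁ h ∧ Solves J Q₂ As₂ h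
  | ex x Q, As, h => ∃ d, Solves J Q As (update h x d)

theorem Solves.map_symbol {As : List J.Base} {h : J.Valuation} (hQ : Solves J Q As h) :
    As.map symbol = Q.symbols := by
  induction Q generalizing As h with
  | tru => rw [show As = [] from hQ]; rfl
  | fls => exact hQ.elim
  | eq s t => rw [hQ.1]; rfl
  | atom p ts => rw [show As = _ from hQ]; rfl
  | and Q₁ Q₂ ih₁ ih₂ =>
    obtain ⟨As₁, As₂, rfl, h₁, h₂⟩ := hQ
    rw [List.map_append, ih₁ h₁, ih₂ h₂]
    rfl
  | ex x Q ih =>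
    obtain ⟨d, hd⟩ := hQ
    exact ih hd

theorem Solves.length_eq {As : List J.Base} {h : J.Valuation} (hQ : Solves J Q As h) :
    As.length = Q.card := by
  rw [← length_symbols, ← hQ.map_symbol, List.length_map]

theorem holds_iff {I : J.Interpretation} {h : J.Valuation} :
    Q.Holds J I h ↔ ∃ As, (∀ A ∈ As, A ∈ I) ∧ Solves J Q As h := by
  induction Q generalizing h with
  | tru => simp [Holds, Solves]
  | fls => simp [Holds, Solves]
  | eq s t => simp [Holds, Solves]
  | atom p ts => simp [Holds, Solves]
  | and Q₁ Q₂ ih₁ ih₂ =>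
    simp only [Holds, Solves, ih₁, ih₂]
    constructor
    · rintro ⟨⟨As₁, hI₁, h₁⟩, As₂, hI₂, h₂⟩
      exact ⟨As₁ ++ As₂, List.forall_mem_append.2 ⟨hI₁, hI₂⟩, As₁, As₂, rfl, h₁, h₂⟩
    · rintro ⟨_, hI, As₁, As₂, rfl, h₁, h₂⟩
      rw [List.forall_mem_append] at hI
      exact ⟨⟨As₁, hI.1, h₁⟩, As₂, hI.2, h₂⟩
  | ex x Q ih => simp only [Holds, Solves, ih]; tauto

theorem mem_msol_iff {Is : List J.Interpretation} (hIs : Is.length = Q.card) {h : J.Valuation} :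
    h ∈ Q.msol J Is ↔ ∃ As, List.Forall₂ (· ∈ ·) As Is ∧ Solves J Q As h := by
  induction Q generalizing Is h with
  | tru => simp [msol, Solves, List.length_eq_zero_iff.1 hIs]
  | fls => simp [msol, Solves]
  | eq s t => simp [msol, Solves, List.length_eq_zero_iff.1 hIs]
  | atom p ts =>
    obtain ⟨I, rfl⟩ := List.length_eq_one_iff.1 hIs
    simp [msol, Solves]
  | and Q₁ Q₂ ih₁ ih₂ =>
    have hlen : Is.length = Q₁.card + Q₂.card := hIs
    have hcard₁ : (Is.take Q₁.card).length = Q₁.card := by simp [hlen]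
    have hcard₂ : (Is.drop Q₁.card).length = Q₂.card := by simp [hlen]
    simp only [msol, Solves, Set.mem_inter_iff, ih₁ hcard₁, ih₂ hcard₂]
    constructor
    · rintro ⟨⟨As₁, hI₁, h₁⟩, As₂, hI₂, h₂⟩
      refine ⟨As₁ ++ As₂, ?_, As₁, As₂, rfl, h₁, h₂⟩
      exact List.take_append_drop Q₁.card Is ▸ List.rel_append hI₁ hI₂
    · rintro ⟨_, hI, As₁, As₂, rfl, h₁, h₂⟩
      rw [← h₁.length_eq]
      exact ⟨⟨As₁, (List.forall₂_take_append _ _ _ hI.flip).flip, h₁⟩,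
        As₂, (List.forall₂_drop_append _ _ _ hI.flip).flip, h₂⟩
  | ex x Q ih =>
    have hd (d) := ih hIs (h := update h x d)
    simp only [msol, Solves, Set.mem_ofPred_eq, hd]
    tauto

theorem leIn_iff : LeIn J Q Q' ↔
    Q.card = Q'.card ∧ ∀ As h, Solves J Q As h → Solves J Q' As h := by
  refine and_congr_right fun hcard => ⟨fun hle As h hQ => ?_, fun hsolves Is hIs h hQ => ?_⟩
  · let singletons : List J.Interpretation := As.map ({·})
    have hlen : singletons.length = Q.card := by simp [singletons, hQ.length_eq]
    have hmem (Bs : List J.Base) : List.Forall₂ (· ∈ ·) Bs singletons ↔ Bs = As := by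
      simp [singletons, List.forall₂_map_right_iff, List.forall₂_eq_eq_eq]
    obtain ⟨Bs, hBs, hQ'⟩ := (mem_msol_iff (hlen.trans hcard)).1
      (hle singletons hlen ((mem_msol_iff hlen).2 ⟨As, (hmem As).2 rfl, hQ⟩))
    exact (hmem Bs).1 hBs ▸ hQ'
  · obtain ⟨As, hAs, hsol⟩ := (mem_msol_iff hIs).1 hQ
    exact (mem_msol_iff (hIs.trans hcard)).2 ⟨As, hAs, hsolves As h hsol⟩

theorem consistent_iff : Consistent.{u, v, w} Q ↔
    ∃ J : PreInterpretation.{u, v, w} L, J.ModelsFEA ∧ ∃ As h, Solves J Q As h := by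
  refine exists_congr fun J => and_congr_right fun _ => ⟨?_, ?_⟩
  · rintro ⟨I, h, hQ⟩
    obtain ⟨As, -, hAs⟩ := holds_iff.1 hQ
    exact ⟨As, h, hAs⟩
  · rintro ⟨As, h, hAs⟩
    exact ⟨{A | A ∈ As}, h, holds_iff.2 ⟨As, fun _ hA => hA, hAs⟩⟩

theorem Solves.exists_finite_local {As : List J.Base} {h : J.Valuation} (hQ : Solves J Q As h) :
    ∃ (V : Set J.Carrier) (X : Set ℕ), V.Finite ∧ X.Finite ∧
      ∀ (J' : PreInterpretation.{u, v, w'} L) (ρ : J.Carrier → J'.Carrier) (h' : J'.Valuation),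
        J.HomOn J' V ρ → (∀ x ∈ X, h' x = ρ (h x)) → Solves J' Q (As.map (mapBase ρ)) h' := by
  induction Q generalizing As h with
  | tru =>
    obtain rfl : As = [] := hQ
    exact ⟨∅, ∅, Set.finite_empty, Set.finite_empty, fun _ _ _ _ _ => rfl⟩
  | fls => exact hQ.elim
  | eq s t =>
    obtain ⟨rfl, hst⟩ := hQ
    refine ⟨_, _, (finite_subtermValues h s).union (finite_subtermValues h t),
      (s.varFinset ∪ t.varFinset).finite_toSet, fun J' ρ h' hρ hh => ⟨rfl, ?_⟩⟩
    rw [(hρ.mono Set.subset_union_left).eval_eq fun x hx => hh x (Finset.mem_union_left _ hx),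
      (hρ.mono Set.subset_union_right).eval_eq fun x hx => hh x (Finset.mem_union_right _ hx), hst]
  | atom p ts =>
    obtain rfl : As = _ := hQ
    refine ⟨_, _, Set.finite_iUnion fun i => finite_subtermValues h (ts i),
      Set.finite_iUnion fun i => (ts i).varFinset.finite_toSet, fun J' ρ h' hρ hh => ?_⟩
    have hargs (i) : J'.eval h' (ts i) = ρ (J.eval h (ts i)) :=
      (hρ.mono (Set.subset_iUnion _ i)).eval_eq fun x hx => hh x (Set.mem_iUnion_of_mem i hx)
    simp only [Solves, hargs]
    rfl
  | and Q₁ Q₂ ih₁ ih₂ =>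
    obtain ⟨As₁, As₂, rfl, h₁, h₂⟩ := hQ
    obtain ⟨V₁, X₁, hV₁, hX₁, hloc₁⟩ := ih₁ h₁
    obtain ⟨V₂, X₂, hV₂, hX₂, hloc₂⟩ := ih₂ h₂
    exact ⟨V₁ ∪ V₂, X₁ ∪ X₂, hV₁.union hV₂, hX₁.union hX₂, fun J' ρ h' hρ hh =>
      ⟨_, _, List.map_append,
        hloc₁ J' ρ h' (hρ.mono Set.subset_union_left) fun x hx => hh x (.inl hx),
        hloc₂ J' ρ h' (hρ.mono Set.subset_union_right) fun x hx => hh x (.inr hx)⟩⟩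
  | ex x Q ih =>
    obtain ⟨d, hd⟩ := hQ
    obtain ⟨V, X, hV, hX, hloc⟩ := ih hd
    refine ⟨V, X, hV, hX, fun J' ρ h' hρ hh => ⟨ρ d, hloc J' ρ _ hρ fun y hy => ?_⟩⟩
    obtain rfl | hyx := eq_or_ne y x
    · simp
    · simp [hyx, hh y hy]

theorem Solves.map {As : List J.Base} {h : J.Valuation} (hQ : Solves J Q As h)
    {ρ : J.Carrier → J'.Carrier} (hρ : J.HomOn J' Set.univ ρ) :
    Solves J' Q (As.map (mapBase ρ)) (ρ ∘ h) := by
  obtain ⟨V, X, -, -, hloc⟩ := hQ.exists_finite_local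
  exact hloc J' ρ (ρ ∘ h) (hρ.mono V.subset_univ) fun _ _ => rfl

theorem Solves.prod {J₁ : PreInterpretation.{u, v, w₁} L}
    {J₂ : PreInterpretation.{u, v, w₂} L} {As : List (J₁.prod J₂).Base}
    {h : (J₁.prod J₂).Valuation} (h₁ : Solves J₁ Q (As.map (mapBase Prod.fst)) (Prod.fst ∘ h))
    (h₂ : Solves J₂ Q (As.map (mapBase Prod.snd)) (Prod.snd ∘ h)) :
    Solves (J₁.prod J₂) Q As h := by
  induction Q generalizing As h with
  | tru => exact List.map_eq_nil_iff.1 h₁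
  | fls => exact h₁
  | eq s t =>
    refine ⟨List.map_eq_nil_iff.1 h₁.1, Prod.ext ?_ ?_⟩
    · simpa only [homOn_fst.eval_comp] using h₁.2
    · simpa only [homOn_snd.eval_comp] using h₂.2
  | atom p ts =>
    simp only [Solves, homOn_fst.eval_comp, homOn_snd.eval_comp] at h₁ h₂
    obtain ⟨A, rfl, hA₁⟩ := List.map_eq_singleton_iff.1 h₁
    have hA₂ := List.singleton_injective h₂
    exact congrArg (fun A => [A]) (prod_base_ext hA₁ hA₂)
  | and Q₁ Q₂ ih₁ ih₂ =>
    obtain ⟨_, _, hAs, h₁₁, h₁₂⟩ := h₁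
    obtain ⟨As₁, As₂, rfl, rfl, rfl⟩ := List.map_eq_append_iff.1 hAs
    obtain ⟨Bs₁, Bs₂, hBs, h₂₁, h₂₂⟩ := h₂
    rw [List.map_append] at hBs
    have hlen : (As₁.map (mapBase Prod.snd)).length = Bs₁.length := by
      rw [h₂₁.length_eq, ← h₁₁.length_eq, List.length_map, List.length_map]
    obtain ⟨rfl, rfl⟩ := List.append_inj hBs hlen
    exact ⟨As₁, As₂, rfl, ih₁ h₁₁ h₂₁, ih₂ h₁₂ h₂₂⟩
  | ex x Q ih =>
    obtain ⟨d₁, hd₁⟩ := h₁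
    obtain ⟨d₂, hd₂⟩ := h₂
    refine ⟨(d₁, d₂), ih ?_ ?_⟩
    · rwa [comp_update]
    · rwa [comp_update]

/-- The argument places of a list of predicate symbols: an index into the list and an argument
of the symbol found there. -/
abbrev Slot (ps : List (Σ n, L.Relations n)) := Σ k : Fin ps.length, Fin ps[k].1

section AtomList

variable {ps : List (Σ n, L.Relations n)}

/-- The generalized atoms with the predicate symbols `ps` and the arguments `a`. -/
def atomList (a : Slot ps → J.Carrier) : List J.Base :=
  List.ofFn fun k : Fin ps.length => ⟨ps[k].1, ps[k].2, fun i => a ⟨k, i⟩⟩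

theorem map_symbol_atomList (a : Slot ps → J.Carrier) : (atomList a).map symbol = ps :=
  (List.map_ofFn ..).trans (List.ofFn_getElem ..)

theorem map_mapBase_atomList (ρ : J.Carrier → J'.Carrier) (a : Slot ps → J.Carrier) :
    (atomList a).map (mapBase ρ) = atomList (ρ ∘ a) :=
  List.map_ofFn ..

theorem exists_atomList_eq {As : List J.Base} (hAs : As.map symbol = ps) :
    ∃ a : Slot ps → J.Carrier, atomList a = As := by
  have hlen : As.length = ps.length := by rw [← hAs, List.length_map]
  have hget (k : Fin ps.length) : symbol As[k] = ps[k] := by simp [← hAs]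
  choose x hx using fun k => exists_eq_of_symbol_eq (hget k)
  refine ⟨fun b => x b.1 b.2, List.ext_getElem (by simp [atomList, hlen]) fun k hk hk' => ?_⟩
  simp only [atomList, List.getElem_ofFn]
  exact hx ⟨k, hlen ▸ hk'⟩

end AtomList

/-- The solutions of `Q` as a class of families: the variables are indexed by `ℕ`, the arguments
of the atoms that a solution requires, of predicate symbols `ps`, by `Slot ps`. -/
def solutions (Q : Query L) (ps : List (Σ n, L.Relations n)) :
    FamilyClass.{u, v, w} L (ℕ ⊕ Slot ps) :=
  fun J => {g | Solves J Q (atomList (g ∘ Sum.inr)) (g ∘ Sum.inl)}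

theorem homClosed_solutions (Q : Query L) (ps : List (Σ n, L.Relations n)) :
    (Q.solutions ps).HomClosed := by
  intro J J' ρ hρ g hg
  have hmap : Solves J' Q (atomList (ρ ∘ g ∘ Sum.inr)) (ρ ∘ g ∘ Sum.inl) :=
    map_mapBase_atomList ρ (g ∘ Sum.inr) ▸ Solves.map hg hρ
  exact hmap

theorem prodClosed_solutions (Q : Query L) (ps : List (Σ n, L.Relations n)) :
    (Q.solutions ps).ProdClosed := by
  intro J₁ J₂ g₁ hg₁ g₂ hg₂
  apply Solves.prod
  · rw [map_mapBase_atomList]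
    exact hg₁
  · rw [map_mapBase_atomList]
    exact hg₂

theorem symbols_eq_of_mem_solutions {ps : List (Σ n, L.Relations n)}
    {g : ℕ ⊕ Slot ps → J.Carrier} (hg : g ∈ Q.solutions ps J) : Q.symbols = ps :=
  hg.map_symbol.symm.trans (map_symbol_atomList _)

theorem Le.solutions_subset (h : Le.{u, v, w} Q Q') (hJ : J.ModelsFEA)
    (ps : List (Σ n, L.Relations n)) : Q.solutions ps J ⊆ Q'.solutions ps J :=
  fun _ hg => (leIn_iff.1 (h J hJ)).2 _ _ hg

theorem le_of_solutions_subset (hcard : Q.card = Q'.card)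
    (hsub : ∀ J : PreInterpretation.{u, v, w} L, J.ModelsFEA →
      Q.solutions Q.symbols J ⊆ Q'.solutions Q.symbols J) : Le.{u, v, w} Q Q' := by
  refine fun J hJ => leIn_iff.2 ⟨hcard, fun As h hQ => ?_⟩
  obtain ⟨a, rfl⟩ := exists_atomList_eq hQ.map_symbol
  exact hsub J hJ (show Sum.elim h a ∈ Q.solutions Q.symbols J from hQ)

theorem Consistent.exists_mem_solutions_finite_pathType (hQ : Consistent.{u, v, w} Q) :
    ∃ T : PreInterpretation.{u, v, w} L, T.ModelsFEA ∧ WellFounded T.Child ∧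
      ∃ s ∈ Q.solutions Q.symbols T, (T.pathType s \ trivialConstraints L _).Finite := by
  classical
  obtain ⟨J, hJ, As, h, hsol⟩ := consistent_iff.1 hQ
  obtain ⟨a, rfl⟩ := exists_atomList_eq hsol.map_symbol
  obtain ⟨V, X, hV, hX, hloc⟩ := hsol.exists_finite_local
  have := hJ.small_functions
  let T : PreInterpretation.{u, v, w} L := termModel L
  let var (x : ℕ) : T.Carrier := Language.Term.var x
  obtain ⟨ρ, hρ, -⟩ := hJ.exists_homOn (hJ.wellFoundedOn_child hV) fun _ => var 0
  let h' : T.Valuation := fun x => if x ∈ X then ρ (h x) else var x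
  have hs : Solves T Q (atomList (ρ ∘ a)) h' :=
    map_mapBase_atomList ρ a ▸ hloc T ρ h' hρ fun x hx => if_pos hx
  let F : Set (ℕ ⊕ Slot Q.symbols) := Sum.inl '' X ∪ Set.range Sum.inr
  have hvar : ∀ i ∉ F, ∃ x, i = .inl x ∧ Sum.elim h' (ρ ∘ a) i = var x := by
    rintro (x | k) hi
    · exact ⟨x, rfl, if_neg fun hx => hi (.inl ⟨x, hx, rfl⟩)⟩
    · exact absurd (.inr ⟨k, rfl⟩) hi
  refine ⟨T, modelsFEA_termModel, wellFounded_child_termModel, Sum.elim h' (ρ ∘ a), hs,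
    modelsFEA_termModel.finite_pathType_diff_trivialConstraints wellFounded_child_termModel
      (F := F) ((hX.image _).union (Set.finite_range _)) (fun i hi => ?_) fun i hi j hj hij => ?_⟩
  · obtain ⟨x, -, hx⟩ := hvar i hi
    exact hx ▸ indecomposable_var x
  · obtain ⟨x, rfl, hx⟩ := hvar i hi
    obtain ⟨y, rfl, hy⟩ := hvar j hj
    exact congrArg Sum.inl (Language.Term.var.inj (hx.symm.trans (hij.trans hy)))

theorem le_of_theory_subset {T : PreInterpretation.{u, v, w} L} (hT : T.ModelsFEA)
    (hw : WellFounded T.Child) {ps : List (Σ n, L.Relations n)} {s : ℕ ⊕ Slot ps → T.Carrier}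
    (hfin : (T.pathType s \ trivialConstraints L _).Finite) (hs : s ∈ Q.solutions ps T)
    (hs' : s ∈ Q'.solutions ps T)
    (hsub : (solutions.{u, v, w} Q' ps).theory ⊆ (solutions.{u, v, w} Q ps).theory) :
    Le.{u, v, w} Q Q' := by
  have hQ := symbols_eq_of_mem_solutions hs
  have hQ' := symbols_eq_of_mem_solutions hs'
  subst hQ
  refine le_of_solutions_subset ?_ fun J hJ => FamilyClass.subset_of_theory_subset hT hfin
    (homClosed_solutions Q' _) (prodClosed_solutions Q' _) hw hs' hsub hJ
  rw [← length_symbols, ← length_symbols, hQ']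

theorem le_out_of_mem_generalizationClasses {C : Quotient (equivalentSetoid.{u, v, w} L)}
    (hC : C ∈ generalizationClasses Q) : Le.{u, v, w} Q C.out := by
  obtain ⟨Q', hQ', rfl⟩ := hC
  have hout : Equivalent.{u, v, w} (Quotient.mk (equivalentSetoid L) Q').out Q' :=
    Quotient.mk_out (s := equivalentSetoid L) Q'
  exact hQ'.trans hout.2

theorem Consistent.finite_generalizationClasses (hQ : Consistent.{u, v, w} Q) :
    (generalizationClasses.{u, v, w} Q).Finite := by
  obtain ⟨T, hT, hw, s, hs, hfin⟩ := hQ.exists_mem_solutions_finite_pathType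
  have hmem : ∀ C ∈ generalizationClasses.{u, v, w} Q, s ∈ C.out.solutions Q.symbols T :=
    fun C hC => (le_out_of_mem_generalizationClasses hC).solutions_subset hT _ hs
  refine Set.Finite.of_injOn
    (f := fun C => (C.out.solutions Q.symbols : FamilyClass.{u, v, w} L _).theory)
    (fun C hC => Set.mem_image_of_mem _ (hmem C hC)) (fun C hC C' hC' hCC' => ?_)
    (FamilyClass.finite_theories hT hfin)
  exact Quotient.out_equiv_out.1
    ⟨le_of_theory_subset hT hw hfin (hmem C hC) (hmem C' hC') hCC'.ge,
      le_of_theory_subset hT hw hfin (hmem C' hC') (hmem C hC) hCC'.le⟩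

theorem Lt.consistent (h : Lt.{u, v, w} Q Q') : Consistent.{u, v, w} Q' := by
  by_contra hQ'
  refine h.2 fun J hJ => leIn_iff.2 ⟨(h.1 J hJ).1.symm, fun As σ hsol => ?_⟩
  exact absurd (consistent_iff.2 ⟨J, hJ, As, σ, hsol⟩) hQ'

theorem le_of_forall_lt_succ {q : ℕ → Query L} (hq : ∀ n, Lt.{u, v, w} (q n) (q (n + 1)))
    {m n : ℕ} (hmn : m ≤ n) : Le.{u, v, w} (q m) (q n) := by
  induction n, hmn using Nat.le_induction with
  | base => exact Le.refl _
  | succ n _ ih => exact ih.trans (hq n).1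

theorem not_exists_forall_lt_succ :
    ¬ ∃ q : ℕ → Query L, ∀ n, Lt.{u, v, w} (q n) (q (n + 1)) := by
  rintro ⟨q, hq⟩
  have hfin := (hq 0).consistent.finite_generalizationClasses
  obtain ⟨m, -, n, -, hmn, hclass⟩ := Set.infinite_univ.exists_lt_map_eq_of_mapsTo
    (f := fun n => Quotient.mk (equivalentSetoid.{u, v, w} L) (q (n + 1)))
    (fun n _ => Set.mem_image_of_mem _ (le_of_forall_lt_succ hq (Nat.le_add_left 1 n))) hfin
  have hequiv : Equivalent.{u, v, w} (q (m + 1)) (q (n + 1)) := Quotient.exact hclass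
  have hle : Le.{u, v, w} (q (m + 1 + 1)) (q (n + 1)) :=
    le_of_forall_lt_succ hq (Nat.succ_le_succ hmn)
  exact (hq (m + 1)).2 (hle.trans hequiv.2)

end Query

end ConjQuery

theorem mainTheorem7 (L : FirstOrder.Language.{u, v}) [Nonempty L.Constants] :
    (∀ Q : ConjQuery.Query L, ConjQuery.Query.Consistent.{u, v, w} Q →
      (ConjQuery.Query.generalizationClasses.{u, v, w} Q).Finite) ∧
    ¬ ∃ Q : ℕ → ConjQuery.Query L, ∀ n : ℕ,
      ConjQuery.Query.Lt.{u, v, w} (Q n) (Q (n + 1)) :=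
  ⟨fun _ hQ => hQ.finite_generalizationClasses, ConjQuery.Query.not_exists_forall_lt_succ⟩
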